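/- Let $\Omega$ be a finite sample space and let $\Delta(\Omega)$ be the measurable space of probability mass functions on $\Omega$. A discrete random variable is a map $X:\Omega\to E_X$ with $E_X$ finite. Two random variables are equivalent if each is a function of the other. Equivalence classes of discrete random variables, with the joint variable $XY$ as product and the constant variable as neutral element, form a commutative idempotent monoid $M$. For $P\in\Delta(\Omega)$ write $P(x)=P(X=x)$, and for $P(x)\neq0$ let $P|_{X=x}\in\Delta(\Omega)$ be the conditional distribution. The variables $X$ and $Y$ are $P$-independent given $Z$ if $P(x,y,z)=P(x\mid z)\,P(y,z)$ for all $x,y,z$ (the right-hand side being $0$ if $P(z)=0$). Let $r\ge 0$, let $\widetilde{\Delta}$ be the set of tuples $(P\|Q_1,\dots,Q_r)\in\Delta(\Omega)^{r+1}$ with $P\ll Q_1,\dots,P\ll Q_r$, and let $G$ be the abelian group of measurable functions $\widetilde{\Delta}\to\mathbb R$, on which $M$ acts additively by $$[X.f](P\|Q_1,\dots,Q_r)=\sum_{x\in E_X}P(x)\,f\big(P|_{X=x}\,\|\,Q_1|_{X=x},\dots,Q_r|_{X=x}\big),$$ where summands with $P(x)=0$ are zero. Let $F:M\to G$ be a function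 that satisfies the chain rule $F(XY)=F(X)+X.F(Y)$ for all $X,Y\in M$ and is of the form $$[F(X)](P\|Q_1,\dots,Q_r)=\sum_{x\in E_X}P(x)\,h\big(P(x),Q_1(x),\dots,Q_r(x)\big)$$ for some function $h:[0,1]^{r+1}\to\mathbb R$. Let $n\ge 0$, let $X_1,\dots,X_n$ be discrete random variables on $\Omega$, let $\mathcal G$ be a graph (undirected, without loops) with vertex set $[n]=\{1,\dots,n\}$, and write $X_A=\prod_{i\in A}X_i$ for $A\subseteq[n]$. Given a ternary relation $X\perp Y\mid Z$ on a commutative monoid, elements $X_1,\dots,X_n$ of it form a Markov random field with respect to the relation and $\mathcal G$ if $X_A\perp X_B\mid X_C$ for all pairwise disjoint $A,B,C\subseteq[n]$ such that every walk in $\mathcal G$ from a vertex of $A$ to a vertex of $B$ passes through a vertex of $C$. Let $M_R\subseteq M$ be the submonoid generated by $X_1,\dots,X_n$, and let $R=R(X_1,\dots,X_n)$ be a stable property of tuples in $\Delta(\Omega)^{r+1}$, that is: $R$ does not change when the $X_i$ are replaced by equivalent random variables; the set of tuples with property $R$ is measurable; and if $R(P\|Q_1,\dots,Q_r)$ holds,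 then $R(P|_{Y=y}\|Q_1|_{Y=y},\dots,Q_r|_{Y=y})$ holds for all $Y\in M_R$ and all values $y$ of $Y$ for which these conditional distributions are defined. Assume that for every $(P\|Q_1,\dots,Q_r)\in\widetilde{\Delta}$ with property $R$, the variables $X_1,\dots,X_n$ form a Markov random field with respect to $\mathcal G$ and $P$-independence, and with respect to $\mathcal G$ and $Q_i$-independence for every $i$. Let $G_R$ be the abelian group of measurable real functions on $\{T\in\widetilde{\Delta}\mid R(T)\}$, on which $M_R$ acts by $Y._Rf=(Y.\tilde f)|_{\{T\in\widetilde\Delta\,\mid\, R(T)\}}$ for any measurable extension $\tilde f$ of $f$ to $\widetilde{\Delta}$, and let $F_R:M_R\to G_R$ send $Y$ to the restriction of $F(Y)$. Say that $X,Y\in M_R$ are $F_R$-independent given $Z\in M_R$ if $Z._R\big(F_R(X)-Y._RF_R(X)\big)=0$. Then $X_1,\dots,X_n$ form an $F_R$-Markov random field with respect to $\mathcal G$, that is, a Markov random field with respect to $F_R$-independence and $\mathcal G$. -/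

import Mathlib

universe u v

namespace InfoMRF

open Set

/-! ### Abstract setting: actions of commutative monoids, chain rule, Markov random fields -/

section Abstract

variable {M : Type*} [CommMonoid M]

/-- `C` separates `A` from `B` in `𝒢`: every walk from a vertex of `A` to a vertex of `B`
passes through a vertex of `C`. -/
def Separates {n : ℕ} (𝒢 : SimpleGraph (Fin n)) (A B C : Finset (Fin n)) : Prop :=
  ∀ a ∈ A, ∀ b ∈ B, ∀ w : 𝒢.Walk a b, ∃ c ∈ C, c ∈ w.support

/-- The global Markov property of `X₁, …, Xₙ` with respect to a graph `𝒢` and a ternary relation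
`ind X Y Z` ("`X` is independent of `Y` given `Z`"). Here `∏ i ∈ A, X i` is the joint `X_A`. -/
def IsMarkovRandomField {n : ℕ} (ind : M → M → M → Prop) (𝒢 : SimpleGraph (Fin n))
    (X : Fin n → M) : Prop :=
  ∀ A B C : Finset (Fin n), Disjoint A B → Disjoint A C → Disjoint B C →
    Separates 𝒢 A B C → ind (∏ i ∈ A, X i) (∏ i ∈ B, X i) (∏ i ∈ C, X i)

variable {G : Type*} [AddCommGroup G] [DistribMulAction M G]

/-- The chain rule `F(XY) = F(X) + X.F(Y)`. -/
def ChainRule (F : M → G) : Prop := ∀ X Y : M, F (X * Y) = F X + X • F Y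

/-- The second order term `F(X; Y) = F(X) - Y.F(X)`. -/
def second (F : M → G) (X Y : M) : G := F X - Y • F X

/-- `F`-independence of `X` and `Y` given `Z`: `Z.F(X; Y) = 0`. -/
def FIndep (F : M → G) (X Y Z : M) : Prop := Z • second F X Y = 0

end Abstract

/-! ### The monoid of equivalence classes of discrete random variables -/

/-- A random variable on `Ω` with values in a finite set. -/
structure RV (Ω : Type u) where
  /-- the value space -/
  E : Type v
  [fintypeE : Fintype E]
  /-- the underlying map -/
  toFun : Ω → E

attribute [instance] RV.fintypeE

namespace RV

variable {Ω : Type u}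

/-- The event `X = x`. -/
def fiber (X : RV.{u, v} Ω) (x : X.E) : Set Ω := X.toFun ⁻¹' {x}

/-- `X` is a deterministic function of `Y`. -/
def IsFunctionOf (X Y : RV.{u, v} Ω) : Prop := ∃ f : Y.E → X.E, X.toFun = f ∘ Y.toFun

/-- The joint variable `XY`. -/
abbrev joint (X Y : RV.{u, v} Ω) : RV.{u, v} Ω where
  E := X.E × Y.E
  toFun ω := (X.toFun ω, Y.toFun ω)

/-- The trivial variable. -/
abbrev trivial : RV.{u, v} Ω where
  E := PUnit
  toFun _ := PUnit.unit

/-- Two random variables are equivalent if each one is a function of the other. -/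
instance setoid : Setoid (RV.{u, v} Ω) where
  r X Y := X.IsFunctionOf Y ∧ Y.IsFunctionOf X
  iseqv :=
    { refl := fun X => ⟨⟨id, rfl⟩, ⟨id, rfl⟩⟩
      symm := fun h => ⟨h.2, h.1⟩
      trans := by
        rintro X Y Z ⟨⟨f, hf⟩, ⟨g, hg⟩⟩ ⟨⟨f', hf'⟩, ⟨g', hg'⟩⟩
        exact ⟨⟨f ∘ f', by rw [hf, hf']; rfl⟩, ⟨g' ∘ g, by rw [hg', hg]; rfl⟩⟩ }

theorem IsFunctionOf.joint {X X' Y Y' : RV.{u, v} Ω} (hX : X.IsFunctionOf X')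
    (hY : Y.IsFunctionOf Y') : (X.joint Y).IsFunctionOf (X'.joint Y') := by
  obtain ⟨f, hf⟩ := hX
  obtain ⟨g, hg⟩ := hY
  refine ⟨Prod.map f g, ?_⟩
  funext ω
  simp [RV.joint, hf, hg]

theorem fiber_joint (X Y : RV.{u, v} Ω) (x : X.E) (y : Y.E) :
    (X.joint Y).fiber (x, y) = X.fiber x ∩ Y.fiber y := by
  ext ω
  exact Prod.ext_iff

theorem fiber_eq_empty_or {X Y : RV.{u, v} Ω} (h : X ≈ Y) (x : X.E) :
    X.fiber x = ∅ ∨ ∃ y, Y.fiber y = X.fiber x := by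
  obtain ⟨⟨f, hf⟩, ⟨g, hg⟩⟩ := h
  rcases (X.fiber x).eq_empty_or_nonempty with h0 | ⟨ω, hω⟩
  · exact Or.inl h0
  · refine Or.inr ⟨Y.toFun ω, ?_⟩
    have hx : X.toFun ω = x := hω
    ext ω'
    simp only [fiber, mem_preimage, mem_singleton_iff]
    constructor
    · intro h'
      rw [← hx, hf]
      simp [h']
    · intro h'
      rw [hg]
      simp [h', hx]

theorem sum_fiber_congr {X Y : RV.{u, v} Ω} (h : X ≈ Y) (Φ : Set Ω → ℝ) (hΦ : Φ ∅ = 0) :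
    ∑ x, Φ (X.fiber x) = ∑ y, Φ (Y.fiber y) := by
  obtain ⟨⟨f, hf⟩, ⟨g, hg⟩⟩ := id h
  have hne : ∀ (Z : RV.{u, v} Ω) (z : Z.E), Φ (Z.fiber z) ≠ 0 → ∃ ω, Z.toFun ω = z := by
    intro Z z hz
    rcases (Z.fiber z).eq_empty_or_nonempty with h0 | ⟨ω, hω⟩
    · exact absurd (h0 ▸ hΦ) hz
    · exact ⟨ω, hω⟩
  have hfib : ∀ ω, Y.fiber (Y.toFun ω) = X.fiber (X.toFun ω) := by
    intro ω
    ext ω'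
    simp only [fiber, mem_preimage, mem_singleton_iff]
    constructor
    · intro h'; simp [hf, h']
    · intro h'; simp [hg, h']
  refine Finset.sum_bij_ne_zero (fun x _ _ => g x) (fun _ _ _ => Finset.mem_univ _) ?_ ?_ ?_
  · intro x₁ _ h₁ x₂ _ h₂ he
    obtain ⟨ω₁, rfl⟩ := hne X x₁ h₁
    obtain ⟨ω₂, rfl⟩ := hne X x₂ h₂
    have he' : Y.toFun ω₁ = Y.toFun ω₂ := by rw [hg]; exact he
    simp [hf, he']
  · intro y _ hy
    obtain ⟨ω, rfl⟩ := hne Y y hy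
    exact ⟨X.toFun ω, Finset.mem_univ _, by rwa [← hfib], by rw [hg]; rfl⟩
  · intro x _ hx
    obtain ⟨ω, rfl⟩ := hne X x hx
    have : g (X.toFun ω) = Y.toFun ω := by rw [hg]; rfl
    rw [this, hfib]

end RV

/-- Equivalence classes of discrete random variables on `Ω`. -/
def RVMonoid (Ω : Type u) : Type (max u (v + 1)) := Quotient (RV.setoid.{u, v} (Ω := Ω))

namespace RVMonoid

variable {Ω : Type u}

/-- The equivalence class of a random variable. -/
def mk (X : RV.{u, v} Ω) : RVMonoid.{u, v} Ω := Quotient.mk _ X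

/-- The joint operation makes equivalence classes of random variables a commutative monoid, with
the class of the trivial variable as neutral element. -/
instance : CommMonoid (RVMonoid.{u, v} Ω) where
  mul := Quotient.map₂ RV.joint fun _ _ h _ _ h' => ⟨h.1.joint h'.1, h.2.joint h'.2⟩
  one := mk RV.trivial
  mul_assoc := by
    rintro ⟨X⟩ ⟨Y⟩ ⟨Z⟩
    exact Quotient.sound ⟨⟨fun p => ((p.1, p.2.1), p.2.2), rfl⟩, ⟨fun p => (p.1.1, p.1.2, p.2), rfl⟩⟩
  one_mul := by
    rintro ⟨X⟩
    exact Quotient.sound ⟨⟨fun x => (PUnit.unit, x), rfl⟩, ⟨Prod.snd, rfl⟩⟩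
  mul_one := by
    rintro ⟨X⟩
    exact Quotient.sound ⟨⟨fun x => (x, PUnit.unit), rfl⟩, ⟨Prod.fst, rfl⟩⟩
  mul_comm := by
    rintro ⟨X⟩ ⟨Y⟩
    exact Quotient.sound ⟨⟨Prod.swap, rfl⟩, ⟨Prod.swap, rfl⟩⟩

theorem mk_mul_mk (X Y : RV.{u, v} Ω) : mk X * mk Y = mk (X.joint Y) := rfl

theorem one_eq_mk : (1 : RVMonoid.{u, v} Ω) = mk RV.trivial := rfl

theorem mul_self (X : RVMonoid.{u, v} Ω) : X * X = X := by
  obtain ⟨X⟩ := X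
  exact Quotient.sound ⟨⟨fun x => (x, x), rfl⟩, ⟨Prod.fst, rfl⟩⟩

end RVMonoid

/-! ### Probability mass functions, conditioning, conditional independence -/

section Probability

variable {Ω : Type u} [Fintype Ω]

/-- The probability mass functions on `Ω`, with the measurable structure inherited from `Ω → ℝ`. -/
abbrev Simplex (Ω : Type u) [Fintype Ω] : Type u := stdSimplex ℝ Ω

/-- The probability of an event. -/
noncomputable def prob (P : Simplex Ω) (A : Set Ω) : ℝ := ∑ ω, A.indicator P.1 ω

theorem prob_nonneg (P : Simplex Ω) (A : Set Ω) : 0 ≤ prob P A :=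
  Finset.sum_nonneg fun ω _ => indicator_nonneg (fun ω _ => P.2.1 ω) ω

theorem prob_le_one (P : Simplex Ω) (A : Set Ω) : prob P A ≤ 1 := by
  rw [← P.2.2]
  exact Finset.sum_le_sum fun ω _ => indicator_le_self' (fun ω _ => P.2.1 ω) ω

theorem prob_empty (P : Simplex Ω) : prob P ∅ = 0 := by simp [prob]

theorem prob_univ (P : Simplex Ω) : prob P univ = 1 := by simpa [prob] using P.2.2

/-- The law of `X` under `P`, as a function with values in `[0, 1]`. -/
noncomputable def law (P : Simplex Ω) (X : RV.{u, v} Ω) (x : X.E) : Icc (0 : ℝ) 1 :=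
  ⟨prob P (X.fiber x), prob_nonneg _ _, prob_le_one _ _⟩

/-- The conditional distribution of `P` given an event `A` of non-zero probability. -/
noncomputable def condOn (P : Simplex Ω) (A : Set Ω) (h : prob P A ≠ 0) : Simplex Ω :=
  ⟨fun ω => A.indicator P.1 ω / prob P A,
    fun ω => div_nonneg (indicator_nonneg (fun ω _ => P.2.1 ω) ω) (prob_nonneg P A), by
      rw [← Finset.sum_div]; exact div_self h⟩

theorem prob_condOn (P : Simplex Ω) (A : Set Ω) (h : prob P A ≠ 0) (B : Set Ω) :
    prob (condOn P A h) B = prob P (A ∩ B) / prob P A := by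
  classical
  unfold condOn
  simp only [prob, Finset.sum_div]
  refine Finset.sum_congr rfl fun ω _ => ?_
  by_cases hB : ω ∈ B <;> by_cases hA : ω ∈ A <;> simp [indicator, hA, hB]

theorem condOn_condOn (P : Simplex Ω) (A B : Set Ω) (h : prob P A ≠ 0)
    (h' : prob (condOn P A h) B ≠ 0) (h'' : prob P (A ∩ B) ≠ 0) :
    condOn (condOn P A h) B h' = condOn P (A ∩ B) h'' := by
  apply Subtype.ext
  funext ω
  change B.indicator (condOn P A h).1 ω / prob (condOn P A h) B = _ / _
  rw [prob_condOn]
  by_cases hB : ω ∈ B <;> by_cases hA : ω ∈ A <;> simp [indicator, hA, hB, condOn]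
  field_simp

/-- `P(x ∣ z)`, the law of `X` under the conditional distribution of `P` given `Z = z`, with the
convention that it is zero if `P(z) = 0`. -/
noncomputable def condLaw (P : Simplex Ω) (X : RV.{u, v} Ω) (x : X.E) (Z : RV.{u, v} Ω) (z : Z.E) :
    ℝ := by
  classical
  exact if h : prob P (Z.fiber z) ≠ 0 then law (condOn P (Z.fiber z) h) X x else 0

/-- Conditional independence of `X` and `Y` given `Z` under `P`:
`P(x, y, z) = P(x ∣ z) * P(y, z)` for all values. -/
def RV.Indep (P : Simplex Ω) (X Y Z : RV.{u, v} Ω) : Prop :=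
  ∀ (x : X.E) (y : Y.E) (z : Z.E),
    (law P ((X.joint Y).joint Z) ((x, y), z) : ℝ) =
      condLaw P X x Z z * law P (Y.joint Z) (y, z)

theorem condLaw_eq (P : Simplex Ω) (X : RV.{u, v} Ω) (x : X.E) (Z : RV.{u, v} Ω) (z : Z.E) :
    condLaw P X x Z z = prob P (Z.fiber z ∩ X.fiber x) / prob P (Z.fiber z) := by
  unfold condLaw
  split_ifs with h
  · exact prob_condOn _ _ _ _
  · rw [not_not.mp h, div_zero]

theorem RV.indep_iff (P : Simplex Ω) (X Y Z : RV.{u, v} Ω) :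
    RV.Indep P X Y Z ↔ ∀ (x : X.E) (y : Y.E) (z : Z.E),
      prob P (X.fiber x ∩ Y.fiber y ∩ Z.fiber z) =
        prob P (Z.fiber z ∩ X.fiber x) / prob P (Z.fiber z) * prob P (Y.fiber y ∩ Z.fiber z) := by
  simp only [RV.Indep, condLaw_eq, law]
  refine forall₃_congr fun x y z => ?_
  rw [RV.fiber_joint (X.joint Y) Z, RV.fiber_joint, RV.fiber_joint]

theorem RV.Indep.congr {P : Simplex Ω} {X Y Z X' Y' Z' : RV.{u, v} Ω} (hX : X ≈ X') (hY : Y ≈ Y')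
    (hZ : Z ≈ Z') (h : RV.Indep P X Y Z) : RV.Indep P X' Y' Z' := by
  rw [RV.indep_iff] at h ⊢
  intro x' y' z'
  rcases RV.fiber_eq_empty_or (Setoid.symm hX) x' with hx | ⟨x, hx⟩
  · simp [hx, prob_empty]
  rcases RV.fiber_eq_empty_or (Setoid.symm hY) y' with hy | ⟨y, hy⟩
  · simp [hy, prob_empty]
  rcases RV.fiber_eq_empty_or (Setoid.symm hZ) z' with hz | ⟨z, hz⟩
  · simp [hz, prob_empty]
  rw [← hx, ← hy, ← hz]
  exact h x y z

/-- `P`-independence on equivalence classes of random variables. -/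
def PIndep (P : Simplex Ω) (X Y Z : RVMonoid.{u, v} Ω) : Prop :=
  Quotient.liftOn Z
    (fun Z' => Quotient.liftOn₂ X Y (fun X' Y' => RV.Indep P X' Y' Z') fun _ _ _ _ hX hY =>
      propext ⟨fun h => h.congr hX hY (Setoid.refl _),
        fun h => h.congr (Setoid.symm hX) (Setoid.symm hY) (Setoid.refl _)⟩)
    fun _ _ hZ => by
      obtain ⟨X'⟩ := X
      obtain ⟨Y'⟩ := Y
      exact propext ⟨fun h => RV.Indep.congr (Setoid.refl _) (Setoid.refl _) hZ h,
        fun h => RV.Indep.congr (Setoid.refl _) (Setoid.refl _) (Setoid.symm hZ) h⟩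

theorem pIndep_mk (P : Simplex Ω) (X Y Z : RV.{u, v} Ω) :
    PIndep P (.mk X) (.mk Y) (.mk Z) ↔ RV.Indep P X Y Z := Iff.rfl

/-- `P` is absolutely continuous with respect to `Q`. -/
def AbsCont (P Q : Simplex Ω) : Prop := ∀ ω, Q.1 ω = 0 → P.1 ω = 0

theorem AbsCont.prob_eq_zero {P Q : Simplex Ω} (h : AbsCont P Q) {A : Set Ω} (hA : prob Q A = 0) :
    prob P A = 0 := by
  have hQ := (Finset.sum_eq_zero_iff_of_nonneg
    fun ω _ => indicator_nonneg (s := A) (fun ω _ => Q.2.1 ω) ω).mp hA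
  refine Finset.sum_eq_zero fun ω hω => ?_
  by_cases hA : ω ∈ A
  · have := hQ ω hω
    rw [indicator_of_mem hA] at this ⊢
    exact h ω this
  · exact indicator_of_notMem hA _

theorem AbsCont.condOn {P Q : Simplex Ω} (h : AbsCont P Q) {A : Set Ω} (hP : prob P A ≠ 0)
    (hQ : prob Q A ≠ 0) : AbsCont (condOn P A hP) (condOn Q A hQ) := by
  intro ω hω
  by_cases hA : ω ∈ A
  · simp only [InfoMRF.condOn, indicator_of_mem hA, div_eq_zero_iff, hQ, or_false] at hω ⊢
    exact Or.inl (h ω hω)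
  · simp [InfoMRF.condOn, hA]

/-! ### Tuples of distributions and the conditioning action -/

/-- Tuples `(P ‖ Q₁, …, Q_r)` of probability mass functions: `P` is entry `0`, `Q_i` is entry `i`. -/
abbrev Tuple (Ω : Type u) [Fintype Ω] (r : ℕ) : Type u := Fin (r + 1) → Simplex Ω

/-- Conditioning all entries of a tuple on an event. -/
noncomputable def Tuple.cond {r : ℕ} (T : Tuple Ω r) (A : Set Ω) (h : ∀ i, prob (T i) A ≠ 0) :
    Tuple Ω r := fun i => condOn (T i) A (h i)

/-- The tuples `(P ‖ Q₁, …, Q_r)` such that `P` is absolutely continuous with respect to each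
`Q_i`. -/
def ACSet (Ω : Type u) [Fintype Ω] (r : ℕ) : Set (Tuple Ω r) :=
  {T | ∀ i : Fin r, AbsCont (T 0) (T i.succ)}

theorem prob_ne_zero_of_ac {r : ℕ} (T : ACSet Ω r) {A : Set Ω} (h : prob (T.1 0) A ≠ 0)
    (i : Fin (r + 1)) : prob (T.1 i) A ≠ 0 := by
  refine Fin.cases h (fun j => ?_) i
  exact fun h0 => h ((T.2 j).prob_eq_zero h0)

/-- Conditioning a tuple in `ACSet Ω r` on an event `A` with `P(A) ≠ 0`. -/
noncomputable def condAC {r : ℕ} (T : ACSet Ω r) (A : Set Ω) (h : prob (T.1 0) A ≠ 0) :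
    ACSet Ω r :=
  ⟨T.1.cond A (prob_ne_zero_of_ac T h), fun j => (T.2 j).condOn _ _⟩

/-- The abelian group of measurable real functions on a measurable space. -/
def Meas (α : Type*) [MeasurableSpace α] : AddSubgroup (α → ℝ) where
  carrier := {f | Measurable f}
  add_mem' hf hg := Measurable.add hf hg
  zero_mem' := measurable_const
  neg_mem' hf := Measurable.neg hf

/-- The abelian group of measurable real functions on `ACSet Ω r`. -/
abbrev InfoGroup (Ω : Type u) [Fintype Ω] (r : ℕ) : Type u := Meas (ACSet Ω r)

/-- The summand `P(A) * f(P|_A ‖ Q₁|_A, …, Q_r|_A)`, which is zero by convention if `P(A) = 0`. -/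
noncomputable def condTerm {r : ℕ} (f : ACSet Ω r → ℝ) (T : ACSet Ω r) (A : Set Ω) : ℝ := by
  classical
  exact if h : prob (T.1 0) A ≠ 0 then prob (T.1 0) A * f (condAC T A h) else 0

theorem condTerm_of_ne {r : ℕ} (f : ACSet Ω r → ℝ) {T : ACSet Ω r} {A : Set Ω}
    (h : prob (T.1 0) A ≠ 0) : condTerm f T A = prob (T.1 0) A * f (condAC T A h) := by
  rw [condTerm, dif_pos h]

theorem condTerm_of_eq {r : ℕ} (f : ACSet Ω r → ℝ) {T : ACSet Ω r} {A : Set Ω}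
    (h : prob (T.1 0) A = 0) : condTerm f T A = 0 := by
  rw [condTerm, dif_neg (not_not.mpr h)]

/-- `[X.f](P ‖ Q₁, …, Q_r) = ∑ x, P(x) * f(P|_{X = x} ‖ Q₁|_{X = x}, …, Q_r|_{X = x})`. -/
noncomputable def RV.condSum {r : ℕ} (X : RV.{u, v} Ω) (f : ACSet Ω r → ℝ) (T : ACSet Ω r) : ℝ :=
  ∑ x, condTerm f T (X.fiber x)

theorem measurable_prob (A : Set Ω) : Measurable fun P : Simplex Ω => prob P A := by
  classical
  unfold prob
  simp only [indicator_apply]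
  refine Finset.measurable_sum _ fun ω _ => ?_
  by_cases h : ω ∈ A
  · simp only [h, if_true]
    exact (measurable_pi_apply ω).comp measurable_subtype_coe
  · simp [h]

theorem measurable_condTerm {r : ℕ} {f : ACSet Ω r → ℝ} (hf : Measurable f) (A : Set Ω) :
    Measurable fun T : ACSet Ω r => condTerm f T A := by
  classical
  have h0 : ∀ i, Measurable fun T : ACSet Ω r => prob (T.1 i) A := fun i =>
    (measurable_prob A).comp ((measurable_pi_apply i).comp measurable_subtype_coe)
  have hs : MeasurableSet {T : ACSet Ω r | prob (T.1 0) A ≠ 0} :=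
    (h0 0) (measurableSet_singleton 0).compl
  have hc : Measurable fun T : {T : ACSet Ω r | prob (T.1 0) A ≠ 0} => condAC T.1 A T.2 := by
    refine Measurable.subtype_mk (measurable_pi_lambda _ fun i => Measurable.subtype_mk
      (measurable_pi_lambda _ fun ω => Measurable.div ?_ ((h0 i).comp measurable_subtype_coe)))
    by_cases h : ω ∈ A
    · simp only [indicator_of_mem h]
      exact (measurable_pi_apply ω).comp (measurable_subtype_coe.comp
        ((measurable_pi_apply i).comp (measurable_subtype_coe.comp measurable_subtype_coe)))
    · simp only [indicator_of_notMem h]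
      exact measurable_const
  exact Measurable.dite (s := {T : ACSet Ω r | prob (T.1 0) A ≠ 0})
    (f := fun T => prob (T.1.1 0) A * f (condAC T.1 A T.2)) (g := fun _ => 0)
    (((h0 0).comp measurable_subtype_coe).mul (hf.comp hc)) measurable_const hs

theorem RV.measurable_condSum {r : ℕ} (X : RV.{u, v} Ω) {f : ACSet Ω r → ℝ} (hf : Measurable f) :
    Measurable (X.condSum f) :=
  Finset.measurable_sum _ fun _ _ => measurable_condTerm hf _

theorem RV.condSum_congr {r : ℕ} {X Y : RV.{u, v} Ω} (h : X ≈ Y) (f : ACSet Ω r → ℝ) :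
    X.condSum f = Y.condSum f := by
  funext T
  exact RV.sum_fiber_congr h (condTerm f T) (condTerm_of_eq _ (prob_empty _))

theorem RV.prob_eq_sum (X : RV.{u, v} Ω) (P : Simplex Ω) (A : Set Ω) :
    prob P A = ∑ x, prob P (A ∩ X.fiber x) := by
  classical
  simp only [prob]
  rw [Finset.sum_comm]
  refine Finset.sum_congr rfl fun ω _ => ?_
  rw [Finset.sum_eq_single (X.toFun ω)]
  · by_cases h : ω ∈ A <;> simp [h, RV.fiber]
  · intro x _ hx
    exact indicator_of_notMem (fun h => hx h.2.symm) _
  · simp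

theorem RV.condSum_joint {r : ℕ} (X Y : RV.{u, v} Ω) (f : ACSet Ω r → ℝ) :
    (X.joint Y).condSum f = X.condSum (Y.condSum f) := by
  funext T
  change ∑ p : X.E × Y.E, condTerm f T ((X.joint Y).fiber p) = _
  rw [Fintype.sum_prod_type]
  refine Finset.sum_congr rfl fun x _ => ?_
  simp only [RV.fiber_joint]
  by_cases hx : prob (T.1 0) (X.fiber x) = 0
  · rw [condTerm_of_eq _ hx]
    refine Finset.sum_eq_zero fun y _ => condTerm_of_eq _ ?_
    have := (Finset.sum_eq_zero_iff_of_nonneg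
      (fun y _ => prob_nonneg (T.1 0) (X.fiber x ∩ Y.fiber y))).mp
      ((Y.prob_eq_sum (T.1 0) (X.fiber x)).symm.trans hx)
    exact this y (Finset.mem_univ _)
  · rw [condTerm_of_ne _ hx, RV.condSum, Finset.mul_sum]
    refine Finset.sum_congr rfl fun y _ => ?_
    have hp : prob ((condAC T (X.fiber x) hx).1 0) (Y.fiber y) =
      prob (T.1 0) (X.fiber x ∩ Y.fiber y) / prob (T.1 0) (X.fiber x) := prob_condOn (T.1 0) _ hx _
    by_cases hxy : prob (T.1 0) (X.fiber x ∩ Y.fiber y) = 0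
    · rw [condTerm_of_eq _ hxy, condTerm_of_eq, mul_zero]
      rw [hp, hxy, zero_div]
    · have hxy' : prob ((condAC T (X.fiber x) hx).1 0) (Y.fiber y) ≠ 0 := by
        rw [hp]; exact div_ne_zero hxy hx
      have hT : condAC (condAC T (X.fiber x) hx) _ hxy' = condAC T (X.fiber x ∩ Y.fiber y) hxy :=
        Subtype.ext (funext fun i => condOn_condOn (T.1 i) _ _ (prob_ne_zero_of_ac T hx i)
          (prob_ne_zero_of_ac (condAC T _ hx) hxy' i) (prob_ne_zero_of_ac T hxy i))
      rw [condTerm_of_ne _ hxy, condTerm_of_ne _ hxy', hT, hp]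
      field_simp

theorem RV.condSum_trivial {r : ℕ} (f : ACSet Ω r → ℝ) :
    (RV.trivial : RV.{u, v} Ω).condSum f = f := by
  funext T
  have hu : (RV.trivial : RV.{u, v} Ω).fiber PUnit.unit = univ := by
    ext ω; exact iff_of_true rfl (mem_univ ω)
  have h1 : prob (T.1 0) univ ≠ 0 := by rw [prob_univ]; exact one_ne_zero
  change ∑ x : PUnit, condTerm f T ((RV.trivial : RV.{u, v} Ω).fiber x) = f T
  rw [Fintype.sum_unique]
  change condTerm f T ((RV.trivial : RV.{u, v} Ω).fiber PUnit.unit) = f T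
  rw [hu, condTerm_of_ne _ h1, prob_univ, one_mul]
  congr 1
  refine Subtype.ext (funext fun i => Subtype.ext (funext fun ω => ?_))
  change univ.indicator (T.1 i).1 ω / prob (T.1 i) univ = _
  rw [prob_univ, indicator_univ, div_one]

/-- The additive action of the monoid of random variables by conditioning. -/
noncomputable instance {r : ℕ} : DistribMulAction (RVMonoid.{u, v} Ω) (InfoGroup Ω r) where
  smul X f := Quotient.liftOn X (fun X' => ⟨X'.condSum f.1, X'.measurable_condSum f.2⟩)
    fun _ _ h => Subtype.ext (RV.condSum_congr h _)
  one_smul f := Subtype.ext (RV.condSum_trivial f.1)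
  mul_smul := by
    rintro ⟨X⟩ ⟨Y⟩ f
    exact Subtype.ext (RV.condSum_joint X Y f.1)
  smul_zero := by
    rintro ⟨X⟩
    refine Subtype.ext (funext fun T => Finset.sum_eq_zero fun x _ => ?_)
    by_cases h : prob (T.1 0) (X.fiber x) = 0
    · exact condTerm_of_eq _ h
    · rw [condTerm_of_ne _ h]; exact mul_zero _
  smul_add := by
    rintro ⟨X⟩ f g
    refine Subtype.ext (funext fun T => ?_)
    refine Eq.trans ?_ Finset.sum_add_distrib
    refine Finset.sum_congr rfl fun x _ => ?_
    by_cases h : prob (T.1 0) (X.fiber x) = 0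
    · simp only [condTerm_of_eq _ h, add_zero]
    · simp only [condTerm_of_ne _ h]; exact mul_add _ _ _

theorem mk_smul_apply {r : ℕ} (X : RV.{u, v} Ω) (f : InfoGroup Ω r) (T : ACSet Ω r) :
    (RVMonoid.mk X • f).1 T = ∑ x, condTerm f.1 T (X.fiber x) := rfl

/-! ### Stable properties and restricted information functions -/

/-- The submonoid generated by (the classes of) `X₁, …, Xₙ`. -/
def generatedMonoid {n : ℕ} (X : Fin n → RV.{u, v} Ω) : Submonoid (RVMonoid.{u, v} Ω) :=
  Submonoid.closure (range fun i => RVMonoid.mk (X i))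

/-- `X i` as an element of the submonoid generated by `X₁, …, Xₙ`. -/
def generator {n : ℕ} (X : Fin n → RV.{u, v} Ω) (i : Fin n) : generatedMonoid X :=
  ⟨RVMonoid.mk (X i), Submonoid.subset_closure (mem_range_self i)⟩

/-- A stable property `R(X₁, …, Xₙ)` of tuples of `r + 1` probability mass functions. -/
structure StableProperty {n : ℕ} (r : ℕ) (X : Fin n → RV.{u, v} Ω) where
  /-- the property, for arbitrary random variables in place of `X₁, …, Xₙ` -/
  prop : (Fin n → RV.{u, v} Ω) → Tuple Ω r → Prop
  /-- the property depends on `X₁, …, Xₙ` only up to equivalence -/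
  wellDefined : ∀ Y : Fin n → RV.{u, v} Ω, (∀ i, Y i ≈ X i) → prop X = prop Y
  /-- the set of tuples with the property is measurable -/
  measurable : MeasurableSet {T : Tuple Ω r | prop X T}
  /-- the property is preserved by conditioning on `Y = y` for `Y` in the submonoid generated by
  `X₁, …, Xₙ`, whenever the conditional distributions are defined -/
  stable : ∀ (T : Tuple Ω r) (Y : RV.{u, v} Ω), RVMonoid.mk Y ∈ generatedMonoid X →
    ∀ (y : Y.E) (h : ∀ i, prob (T i) (Y.fiber y) ≠ 0),
      prop X T → prop X (T.cond (Y.fiber y) h)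

/-- The property that `X₁, …, Xₙ` form a Markov random field with respect to `𝒢` for every
distribution of the tuple. -/
def MRFProperty {n r : ℕ} (𝒢 : SimpleGraph (Fin n)) (X : Fin n → RV.{u, v} Ω) (T : Tuple Ω r) :
    Prop :=
  ∀ i, IsMarkovRandomField (PIndep (T i)) 𝒢 fun j => RVMonoid.mk (X j)

namespace StableProperty

variable {n r : ℕ} {X : Fin n → RV.{u, v} Ω} (R : StableProperty r X)

/-- The tuples in `ACSet Ω r` with the property `R`. -/
def carrier : Set (ACSet Ω r) := {T | R.prop X T.1}

theorem measurableSet_carrier : MeasurableSet R.carrier := measurable_subtype_coe R.measurable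

/-- The abelian group of measurable real functions on the tuples in `ACSet Ω r` with the
property `R`. -/
abbrev Group : Type u := Meas R.carrier

/-- Restriction of a measurable function to the tuples with the property `R`. -/
def restrict (f : InfoGroup Ω r) : R.Group := ⟨fun T => f.1 T.1, f.2.comp measurable_subtype_coe⟩

/-- Extension of a measurable function by zero. -/
noncomputable def extend (f : R.Group) : InfoGroup Ω r := by
  classical
  exact ⟨fun T => if h : T ∈ R.carrier then f.1 ⟨T, h⟩ else 0,
    Measurable.dite f.2 measurable_const R.measurableSet_carrier⟩

theorem restrict_extend (f : R.Group) : R.restrict (R.extend f) = f := by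
  refine Subtype.ext (funext fun T => ?_)
  exact dif_pos T.2

/-- The action of an element of the generated submonoid on a function on all of `ACSet Ω r` only
depends on the restriction of the function, so any measurable extension defines the same action. -/
theorem restrict_smul_congr (Y : generatedMonoid X) {f g : InfoGroup Ω r}
    (h : R.restrict f = R.restrict g) : R.restrict (Y.1 • f) = R.restrict (Y.1 • g) := by
  obtain ⟨⟨Y⟩, hY⟩ := Y
  refine Subtype.ext (funext fun T => Finset.sum_congr rfl fun y _ => ?_)
  by_cases h0 : prob (T.1.1 0) (Y.fiber y) = 0
  · rw [condTerm_of_eq _ h0, condTerm_of_eq _ h0]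
  · rw [condTerm_of_ne _ h0, condTerm_of_ne _ h0]
    congr 1
    exact congrFun (congrArg Subtype.val h)
      ⟨condAC T.1 _ h0, R.stable T.1.1 Y hY y (prob_ne_zero_of_ac T.1 h0) T.2⟩

/-- The restricted action: extend measurably, act, restrict. -/
noncomputable instance : DistribMulAction (generatedMonoid X) R.Group where
  smul Y f := R.restrict (Y.1 • R.extend f)
  one_smul f := by
    change R.restrict ((1 : RVMonoid.{u, v} Ω) • R.extend f) = f
    rw [one_smul, restrict_extend]
  mul_smul Y Z f := by
    change R.restrict ((Y.1 * Z.1) • R.extend f) =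
      R.restrict (Y.1 • R.extend (R.restrict (Z.1 • R.extend f)))
    rw [mul_smul]
    exact R.restrict_smul_congr Y (R.restrict_extend _).symm
  smul_zero Y := by
    change R.restrict (Y.1 • R.extend 0) = 0
    rw [R.restrict_smul_congr Y (g := 0) (R.restrict_extend 0), smul_zero]
    rfl
  smul_add Y f g := by
    change R.restrict (Y.1 • R.extend (f + g)) =
      R.restrict (Y.1 • R.extend f + Y.1 • R.extend g)
    rw [← smul_add]
    refine R.restrict_smul_congr Y ?_
    rw [restrict_extend]
    exact congrArg₂ (· + ·) (R.restrict_extend f).symm (R.restrict_extend g).symm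

/-- The restricted information function `F_R`, from the generated submonoid to the functions on
the tuples with property `R`. -/
def restrictInfo (F : RVMonoid.{u, v} Ω → InfoGroup Ω r) (Y : generatedMonoid X) : R.Group :=
  R.restrict (F Y.1)

end StableProperty

end Probability

end InfoMRF

open InfoMRF

namespace InfoMRF

open Set

/-! Since the action is additive and multiplicative, `Z • second F X Y` equals `Z.F(X) - (ZY).F(X)`.
At a tuple, the first term averages the values of `F(X)` at the tuple conditioned on `Z = z`, and
the second averages its values at the tuple conditioned on `Z = z, Y = y`. The special form of `F`
makes `F(X)` a function of the laws of `X` under the entries of the tuple alone, and conditional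
independence in every entry says exactly that the further conditioning on `Y = y` leaves these laws
unchanged (`RV.Indep.law_condOn`). So the inner average over `y` is over a constant, and `P(z) = ∑
y, P(z, y)` makes both terms equal (`smul_second_apply_eq_zero`).

The argument is pointwise in the tuple, so it suffices to have independence at the tuples with
property `R`. Stability of `R` makes restriction compatible with the two actions, whence the second
order term of the restricted function is the restriction of that of `F`
(`StableProperty.smul_second_restrictInfo`). -/

theorem coe_prod_generator {Ω : Type u} {n : ℕ} (X : Fin n → RV.{u, v} Ω) (A : Finset (Fin n)) :
    ((∏ i ∈ A, generator X i : generatedMonoid X) : RVMonoid.{u, v} Ω) =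
      ∏ i ∈ A, RVMonoid.mk (X i) :=
  Submonoid.coe_finsetProd _ _ _

/-! ### Second order terms under conditional independence -/

section

variable {Ω : Type u} [Fintype Ω]

/-- If `X` and `Y` are independent given `Z`, then conditioning on `Z = z` and on `Z = z, Y = y`
leads to the same law of `X`. -/
theorem RV.Indep.law_condOn {P : Simplex Ω} {X Y Z : RV.{u, v} Ω} (h : RV.Indep P X Y Z)
    {y : Y.E} {z : Z.E} (hz : prob P (Z.fiber z) ≠ 0)
    (hzy : prob P (Z.fiber z ∩ Y.fiber y) ≠ 0) (x : X.E) :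
    law (condOn P (Z.fiber z ∩ Y.fiber y) hzy) X x = law (condOn P (Z.fiber z) hz) X x := by
  apply Subtype.ext
  change prob _ _ = prob _ _
  -- Clearing the denominator `P(z, y)` leaves the product formula of `RV.indep_iff`, up to the
  -- order of the intersections.
  rw [prob_condOn, prob_condOn, div_eq_iff hzy]
  have := (RV.indep_iff P X Y Z).mp h x y z
  have h₁ : Z.fiber z ∩ Y.fiber y ∩ X.fiber x = X.fiber x ∩ Y.fiber y ∩ Z.fiber z := by
    ac_rfl
  rwa [h₁, inter_comm (Z.fiber z) (Y.fiber y)]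

/-- A function of variables and tuples which depends only on the laws of the variable vanishes
to second order on conditionally independent variables. -/
theorem smul_second_apply_eq_zero {r : ℕ} {F : RVMonoid.{u, v} Ω → InfoGroup Ω r}
    {h : (Fin (r + 1) → Icc (0 : ℝ) 1) → ℝ}
    (hF : ∀ (X : RV.{u, v} Ω) (T : ACSet Ω r),
      (F (RVMonoid.mk X)).1 T = ∑ x : X.E, (law (T.1 0) X x : ℝ) * h (fun i => law (T.1 i) X x))
    (X Y Z : RVMonoid.{u, v} Ω) (T : ACSet Ω r) (hT : ∀ i, PIndep (T.1 i) X Y Z) :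
    (Z • second F X Y).1 T = 0 := by
  obtain ⟨X⟩ := X
  obtain ⟨Y⟩ := Y
  obtain ⟨Z⟩ := Z
  change (RVMonoid.mk Z • (F (RVMonoid.mk X) - RVMonoid.mk Y • F (RVMonoid.mk X))).1 T = 0
  replace hT : ∀ i, RV.Indep (T.1 i) X Y Z := hT
  rw [smul_sub, ← mul_smul, RVMonoid.mk_mul_mk]
  change (RVMonoid.mk Z • F (RVMonoid.mk X)).1 T -
    (RVMonoid.mk (Z.joint Y) • F (RVMonoid.mk X)).1 T = 0
  rw [sub_eq_zero, mk_smul_apply, mk_smul_apply]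
  -- The sum over values of the joint variable becomes a double sum, to be compared for each fixed
  -- `z`.
  refine Eq.trans ?_ (Fintype.sum_prod_type _).symm
  refine Finset.sum_congr rfl fun z _ => ?_
  simp only [RV.fiber_joint]
  have hsum := Y.prob_eq_sum (T.1 0) (Z.fiber z)
  -- If `P(z) = 0`, the nonnegative numbers `P(z, y)` sum to zero, so every term on both sides is
  -- zero by convention.
  by_cases hz : prob (T.1 0) (Z.fiber z) = 0
  · rw [condTerm_of_eq _ hz]
    refine (Finset.sum_eq_zero fun y _ => condTerm_of_eq _ ?_).symm
    exact (Finset.sum_eq_zero_iff_of_nonneg fun y _ => prob_nonneg _ _).mp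
      (hsum.symm.trans hz) y (Finset.mem_univ _)
  -- Splitting the weight `P(z)` as `∑ y, P(z, y)` allows a comparison term by term in `y`.
  · rw [condTerm_of_ne _ hz, hsum, Finset.sum_mul]
    refine Finset.sum_congr rfl fun y _ => ?_
    by_cases hzy : prob (T.1 0) (Z.fiber z ∩ Y.fiber y) = 0
    · rw [condTerm_of_eq _ hzy, hzy, zero_mul]
    · rw [condTerm_of_ne _ hzy, hF, hF]
      -- Absolute continuity enters here: `P(z, y) ≠ 0` forces `Q_i(z, y) ≠ 0`, so all entries can
      -- be conditioned.
      have hlaw : ∀ i x, law ((condAC T _ hzy).1 i) X x = law ((condAC T _ hz).1 i) X x :=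
        fun i x => (hT i).law_condOn (prob_ne_zero_of_ac T hz i) (prob_ne_zero_of_ac T hzy i) x
      simp only [hlaw]

/-! ### Passage to the tuples with property `R` -/

/-- The function `f` is itself a measurable extension of its restriction, and the restricted action
does not depend on the extension chosen. -/
theorem StableProperty.smul_restrict {n r : ℕ} {X : Fin n → RV.{u, v} Ω} (R : StableProperty r X)
    (Y : generatedMonoid X) (f : InfoGroup Ω r) : Y • R.restrict f = R.restrict (Y.1 • f) :=
  R.restrict_smul_congr Y (R.restrict_extend _)

/-- Restriction is additive and, by `smul_restrict`, equivariant, so it commutes with forming second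
order terms and acting on them. -/
theorem StableProperty.smul_second_restrictInfo {n r : ℕ} {X : Fin n → RV.{u, v} Ω}
    (R : StableProperty r X) (F : RVMonoid.{u, v} Ω → InfoGroup Ω r)
    (U V W : generatedMonoid X) :
    W • second (R.restrictInfo F) U V = R.restrict (W.1 • second F U.1 V.1) := by
  rw [← R.smul_restrict, second, restrictInfo, R.smul_restrict]
  rfl

end

end InfoMRF

theorem mainTheorem7 {Ω : Type u} [Fintype Ω] (r n : ℕ)
    (F : RVMonoid.{u, v} Ω → InfoGroup Ω r) (hChain : ChainRule F)
    (h : (Fin (r + 1) → Set.Icc (0 : ℝ) 1) → ℝ)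
    (hF : ∀ (X : RV.{u, v} Ω) (T : ACSet Ω r),
      (F (RVMonoid.mk X)).1 T = ∑ x : X.E, (law (T.1 0) X x : ℝ) * h (fun i => law (T.1 i) X x))
    (X : Fin n → RV.{u, v} Ω) (𝒢 : SimpleGraph (Fin n))
    (R : StableProperty r X)
    (hR : ∀ T ∈ ACSet Ω r, R.prop X T → MRFProperty 𝒢 X T) :
    IsMarkovRandomField (FIndep (R.restrictInfo F)) 𝒢 (generator X) := by
  intro A B C hAB hAC hBC hsep
  rw [FIndep, R.smul_second_restrictInfo]
  refine Subtype.ext (funext fun T => ?_)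
  refine smul_second_apply_eq_zero hF _ _ _ T.1 fun i => ?_
  -- The joints in the goal are formed in the generated submonoid, those in `hR` in the full monoid.
  simp only [coe_prod_generator]
  exact hR T.1.1 T.1.2 T.2 i A B C hAB hAC hBC hsep
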